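/- An MV-algebra is an algebra $\mathbf A=(A,\oplus,\neg,0)$ of type $(2,1,0)$ such that, with $1:=\neg 0$, for all $x,y,z\in A$: $x\oplus y=y\oplus x$; $x\oplus(y\oplus z)=(x\oplus y)\oplus z$; $x\oplus 0=x$; $\neg\neg x=x$; $x\oplus 1=1$; $\neg(\neg x\oplus y)\oplus y=\neg(\neg y\oplus x)\oplus x$. It is partially ordered by $x\le y\iff \neg x\oplus y=1$, it is linearly ordered (an MV-chain) if this order is total, and it is nontrivial if it has more than one element. The set $\mathbb Q\cap[0,1]$ is an MV-algebra with $x\oplus y=\min(x+y,1)$, $\neg x=1-x$ and $0$. Products carry the coordinatewise operations. For an ultrafilter $U$ on a set $I$, the ultraproduct of MV-algebras $\mathbf A_i$ ($i\in I$) is the quotient of $\prod_{i\in I}\mathbf A_i$ by the congruence $x\sim y\iff\{i\in I: x(i)=y(i)\}\in U$; it is an ultrapower of $\mathbf A$ if $\mathbf A_i=\mathbf A$ for all $i$. An embedding is an injective map preserving $\oplus$, $\neg$ and $0$. Theorem. 1. Every nontrivial linearly ordered MV-algebra can be embedded into an ultrapower of $\mathbb Q\cap[0,1]$. 2. Every MV-algebra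 can be embedded into a product of (possibly different) ultrapowers of $\mathbb Q\cap[0,1]$. 3. Every nontrivial MV-algebra can be embedded into an ultrapower of the countable power $(\mathbb Q\cap[0,1])^{\mathbb N}$. 4. Every MV-algebra can be embedded into an ultraproduct of finite powers $(\mathbb Q\cap[0,1])^{n_i}$, $n_i\in\{0,1,2,\dots\}$. (The one-element MV-algebra embeds into the empty product in 2 and into an ultraproduct of zeroth powers in 4.) -/

import Mathlib

universe u v w

/-- An MV-algebra: an algebra `(A, ⊕, ¬, 0)` of type `(2, 1, 0)` satisfying the six usual axioms,
where `1` stands for `¬ 0`. -/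
class MVAlgebra (A : Type u) where
  oplus : A → A → A
  neg : A → A
  zero : A
  oplus_comm : ∀ x y, oplus x y = oplus y x
  oplus_assoc : ∀ x y z, oplus x (oplus y z) = oplus (oplus x y) z
  oplus_zero : ∀ x, oplus x zero = x
  neg_neg : ∀ x, neg (neg x) = x
  oplus_one : ∀ x, oplus x (neg zero) = neg zero
  lukasiewicz : ∀ x y, oplus (neg (oplus (neg x) y)) y = oplus (neg (oplus (neg y) x)) x

namespace MVAlgebra

/-- The top element `1 := ¬ 0`. -/
def one (A : Type u) [MVAlgebra A] : A := neg zero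

/-- The natural order: `x ≤ y` if and only if `¬ x ⊕ y = 1`. -/
def le {A : Type u} [MVAlgebra A] (x y : A) : Prop := oplus (neg x) y = one A

/-- The natural order of `A` is linear. It is a partial order on every MV-algebra, so this is
totality. -/
def IsLinearlyOrdered (A : Type u) [MVAlgebra A] : Prop := ∀ x y : A, le x y ∨ le y x

/-- Embeddings of MV-algebras: injective maps preserving `⊕`, `¬` and `0`. -/
structure IsEmbedding {A : Type u} {B : Type v} [MVAlgebra A] [MVAlgebra B] (f : A → B) : Prop where
  injective : Function.Injective f
  map_oplus : ∀ x y, f (oplus x y) = oplus (f x) (f y)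
  map_neg : ∀ x, f (neg x) = neg (f x)
  map_zero : f zero = zero

/-- `A` can be embedded into `B`. -/
def EmbedsInto (A : Type u) (B : Type v) [MVAlgebra A] [MVAlgebra B] : Prop :=
  ∃ f : A → B, IsEmbedding f

/-- The carrier `ℚ ∩ [0, 1]`. -/
abbrev RatUnit : Type := Set.Icc (0 : ℚ) 1

/-- The MV-algebra `ℚ ∩ [0, 1]`, with `x ⊕ y = min (x + y) 1` and `¬ x = 1 - x`. -/
instance instRatUnit : MVAlgebra RatUnit where
  oplus x y := ⟨min (x.1 + y.1) 1, le_min (add_nonneg x.2.1 y.2.1) zero_le_one, min_le_right _ _⟩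
  neg x := ⟨1 - x.1, sub_nonneg.2 x.2.2, sub_le_self _ x.2.1⟩
  zero := ⟨0, le_rfl, zero_le_one⟩
  oplus_comm x y := by simp only [add_comm]
  oplus_assoc := by
    rintro ⟨x, hx0, hx1⟩ ⟨y, hy0, hy1⟩ ⟨z, hz0, hz1⟩
    ext
    simp only [min_def]
    split_ifs <;> linarith
  oplus_zero := by
    rintro ⟨x, hx0, hx1⟩
    ext
    simp [hx1]
  neg_neg := by
    rintro ⟨x, hx0, hx1⟩
    ext
    simp
  oplus_one := by
    rintro ⟨x, hx0, hx1⟩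
    ext
    simp [hx0]
  lukasiewicz := by
    rintro ⟨x, hx0, hx1⟩ ⟨y, hy0, hy1⟩
    ext
    simp only [min_def]
    split_ifs <;> linarith

/-- The direct product of a family of MV-algebras, with coordinatewise operations. -/
instance instPi {ι : Type v} {B : ι → Type w} [∀ i, MVAlgebra (B i)] :
    MVAlgebra (∀ i, B i) where
  oplus x y := fun i => oplus (x i) (y i)
  neg x := fun i => neg (x i)
  zero := fun _ => zero
  oplus_comm x y := funext fun i => oplus_comm (x i) (y i)
  oplus_assoc x y z := funext fun i => oplus_assoc (x i) (y i) (z i)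
  oplus_zero x := funext fun i => oplus_zero (x i)
  neg_neg x := funext fun i => neg_neg (x i)
  oplus_one x := funext fun i => oplus_one (x i)
  lukasiewicz x y := funext fun i => lukasiewicz (x i) (y i)

/-- The carrier of the ultraproduct of `B` over `U`: the quotient of `∏ i, B i` by the relation
`{i | x i = y i} ∈ U`. -/
abbrev Ultraproduct {I : Type v} (U : Ultrafilter I) (B : I → Type w) : Type (max v w) :=
  (U : Filter I).Product B

/-- The ultrapower of `B` over `U`. -/
abbrev Ultrapower {I : Type v} (U : Ultrafilter I) (B : Type w) : Type (max v w) :=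
  Ultraproduct U (fun _ => B)

/-- The ultraproduct of MV-algebras is the quotient algebra of their direct product. -/
instance instUltraproduct {I : Type v} (U : Ultrafilter I) (B : I → Type w)
    [∀ i, MVAlgebra (B i)] : MVAlgebra (Ultraproduct U B) where
  oplus := Quotient.map₂ (fun x y : ∀ i, B i => oplus x y) (by
    intro x x' hx y y' hy
    filter_upwards [hx, hy] with i h1 h2
    exact congrArg₂ oplus h1 h2)
  neg := Quotient.map (fun x : ∀ i, B i => neg x) (by
    intro x x' hx
    filter_upwards [hx] with i h1
    exact congrArg neg h1)
  zero := Quotient.mk _ (zero : ∀ i, B i)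
  oplus_comm := by
    rintro ⟨x⟩ ⟨y⟩
    exact congrArg (Quotient.mk _) (oplus_comm x y)
  oplus_assoc := by
    rintro ⟨x⟩ ⟨y⟩ ⟨z⟩
    exact congrArg (Quotient.mk _) (oplus_assoc x y z)
  oplus_zero := by
    rintro ⟨x⟩
    exact congrArg (Quotient.mk _) (oplus_zero x)
  neg_neg := by
    rintro ⟨x⟩
    exact congrArg (Quotient.mk _) (neg_neg x)
  oplus_one := by
    rintro ⟨x⟩
    exact congrArg (Quotient.mk _) (oplus_one x)
  lukasiewicz := by
    rintro ⟨x⟩ ⟨y⟩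
    exact congrArg (Quotient.mk _) (lukasiewicz x y)

end MVAlgebra

namespace MVAlgebra

/-! An algebra embeds into an ultraproduct as soon as each of its finite subsets is mapped
injectively, respecting the operations on that subset, into the corresponding factor: use an
ultrafilter on the finite subsets containing every cone `{S | x ∈ S}` (`embedsInto_ultraproduct`).
Everything thus reduces to finite parts.

For a chain, adjoin integer parts: pairs `floor + frac`, added with carry, form a linearly ordered
abelian group whose interval from 0 to the image of 1 is the chain (`exists_group_of_chain`).
Fourier–Motzkin elimination turns a finite piece of such a group into rationals, keeping sums and
strict inequalities (`exists_rat_of_chain`).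

For a general algebra, an ideal maximal among those omitting a nonzero element is prime and its
quotient is a chain, so chains separate points (`exists_chain_separating`). One map per pair of
distinct elements then yields the product of ultrapowers and the embeddings of finite parts into
powers. -/

/-- `f` preserves the operations on arguments from `S`. -/
structure IsHomOn {A : Type u} {B : Type v} [MVAlgebra A] [MVAlgebra B] (S : Set A) (f : A → B) :
    Prop where
  map_oplus : ∀ x ∈ S, ∀ y ∈ S, f (oplus x y) = oplus (f x) (f y)
  map_neg : ∀ x ∈ S, f (neg x) = neg (f x)
  map_zero : f zero = zero

/-! ### Order, truncated difference and lattice operations of an MV-algebra -/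

section Order

variable {A : Type u} [MVAlgebra A]

local prefix:max "∼" => MVAlgebra.neg

/-- The commutative monoid `(A, ⊕, 0)`. -/
abbrev addCommMonoid : AddCommMonoid A where
  add := oplus
  zero := zero
  add_assoc x y z := (oplus_assoc x y z).symm
  add_comm := oplus_comm
  zero_add x := (oplus_comm zero x).trans (oplus_zero x)
  add_zero := oplus_zero
  nsmul n x := n.rec zero fun _ y => oplus y x
  nsmul_zero _ := rfl
  nsmul_succ _ _ := rfl

attribute [local instance] addCommMonoid

/-- The truncated difference `x ⊖ y = ¬ (¬ x ⊕ y)`. -/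
abbrev truncatedSub : Sub A := ⟨fun x y => ∼(∼x + y)⟩

attribute [local instance] truncatedSub

theorem sub_def (x y : A) : x - y = ∼(∼x + y) := rfl

/-- The Łukasiewicz axiom at `y = 1`. -/
theorem neg_add_self_eq_one (x : A) : ∼x + x = one A := by
  have h := lukasiewicz x (one A)
  have h1 : oplus (neg (oplus (neg x) (one A))) (one A) = one A := oplus_one _
  have h2 : neg (one A) = zero := MVAlgebra.neg_neg _
  rw [h1, h2, oplus_comm zero, oplus_zero] at h
  exact h.symm

theorem neg_one_eq_zero : ∼(one A) = 0 := MVAlgebra.neg_neg _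

theorem neg_zero_eq_one : ∼(0 : A) = one A := rfl

theorem add_one_eq_one (x : A) : x + one A = one A := oplus_one x

theorem one_add_eq_one (x : A) : one A + x = one A := by rw [add_comm, add_one_eq_one]

theorem sub_add_comm_of_join (x y : A) : x - y + y = y - x + x := lukasiewicz x y

theorem sub_add_cancel_of_le {x y : A} (h : ∼x + y = one A) : y - x + x = y := by
  rw [← sub_add_comm_of_join, sub_def, h, neg_one_eq_zero, zero_add]

theorem le_of_add_eq {x y z : A} (h : x + z = y) : ∼x + y = one A := by
  rw [← h, ← add_assoc, neg_add_self_eq_one, one_add_eq_one]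

/-- This adjunction is `OrderedSub`, which opens the general theory of truncated subtraction. -/
theorem sub_residuation (x y z : A) : ∼(x - y) + z = one A ↔ ∼x + (z + y) = one A := by
  rw [sub_def, MVAlgebra.neg_neg, add_assoc, add_comm z]

/-- The natural order. -/
abbrev partialOrder : PartialOrder A where
  le := MVAlgebra.le
  le_refl := neg_add_self_eq_one
  le_trans x y z hxy hyz := by
    have h : z - y + (y - x) + x = z := by
      rw [add_assoc, sub_add_cancel_of_le hxy, sub_add_cancel_of_le hyz]
    exact le_of_add_eq ((add_comm _ _).trans h)
  le_antisymm x y hxy hyx := by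
    have h := sub_add_cancel_of_le hxy
    rwa [sub_def, show ∼y + x = one A from hyx, neg_one_eq_zero, zero_add] at h

attribute [local instance] partialOrder

theorem le_iff_neg_add {x y : A} : x ≤ y ↔ ∼x + y = one A := Iff.rfl

theorem canonicallyOrderedAdd : CanonicallyOrderedAdd A where
  exists_add_of_le {x y} h := ⟨y - x, by rw [add_comm, sub_add_cancel_of_le h]⟩
  le_add_self x y := le_of_add_eq (add_comm _ _)
  le_self_add x y := le_of_add_eq rfl

attribute [local instance] canonicallyOrderedAdd

theorem isOrderedAddMonoid : IsOrderedAddMonoid A where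
  add_le_add_left x y h z := by
    obtain ⟨w, rfl⟩ := exists_add_of_le h
    exact le_of_add_eq (z := w) (add_right_comm _ _ _)

attribute [local instance] isOrderedAddMonoid

theorem orderedSub : OrderedSub A where
  tsub_le_iff_right x y z := sub_residuation x y z

attribute [local instance] orderedSub

theorem neg_le_neg_iff' {x y : A} : ∼x ≤ ∼y ↔ y ≤ x := by
  rw [le_iff_neg_add, le_iff_neg_add, MVAlgebra.neg_neg, add_comm]

/-- The lattice structure, with join `x ⊖ y ⊕ y`. -/
abbrev lattice : Lattice A where
  sup x y := x - y + y
  inf x y := ∼(∼x - ∼y + ∼y)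
  le_sup_left x y := le_tsub_add
  le_sup_right x y := le_add_self
  sup_le x y z hx hy := by
    rw [← sub_add_cancel_of_le hy]
    exact add_le_add_left (tsub_le_tsub_right hx y) y
  inf_le_left x y := by
    rw [← neg_le_neg_iff', MVAlgebra.neg_neg]
    exact le_tsub_add
  inf_le_right x y := by
    rw [← neg_le_neg_iff', MVAlgebra.neg_neg]
    exact le_add_self
  le_inf x y z hx hy := by
    rw [← neg_le_neg_iff', MVAlgebra.neg_neg, ← sub_add_cancel_of_le (neg_le_neg_iff'.2 hy)]
    exact add_le_add_left (tsub_le_tsub_right (neg_le_neg_iff'.2 hx) _) _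

attribute [local instance] lattice

theorem le_one (x : A) : x ≤ one A := add_one_eq_one _

theorem neg_sub_neg (x y : A) : ∼x - ∼y = y - x := by
  rw [sub_def, sub_def, MVAlgebra.neg_neg, add_comm]

theorem neg_eq_one_sub (x : A) : ∼x = one A - x := by
  rw [sub_def, neg_one_eq_zero, zero_add]

/-- `(x ⊕ y) ⊖ x = y ∧ ¬ x`. -/
theorem add_sub_eq_inf_neg (x y : A) : x + y - x = y ⊓ ∼x := by
  change _ = ∼(∼y - ∼∼x + ∼∼x)
  rw [MVAlgebra.neg_neg, sub_def (∼y), MVAlgebra.neg_neg, sub_def, add_comm x y]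

/-- Prelinearity: applied to this meet, primeness of an ideal makes any two classes comparable. -/
theorem sub_inf_sub (x y : A) : (x - y) ⊓ (y - x) = 0 := by
  set d := y - x with hd
  set c := ∼x + d with hc
  have hc' : ∼c = x - d := rfl
  have hd' : ∼d = ∼y + x := MVAlgebra.neg_neg _
  -- Both sides equal `(y ⊕ c) ⊖ (y ⊕ ¬x)`, because `(¬c ⊕ ¬y) ⊖ ¬c = c ∧ ¬y = (y ⊕ c) ⊖ y`.
  have h1 : (x - y) ⊓ d = (∼c + ∼y) - ∼c - ∼x := by
    have e1 := add_sub_eq_inf_neg (∼(x - y)) d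
    have e2 := add_sub_eq_inf_neg (∼c) (∼y)
    rw [MVAlgebra.neg_neg] at e1 e2
    have e3 : ∼(x - y) = y + ∼x := (MVAlgebra.neg_neg _).trans (add_comm _ _)
    rw [e2, inf_comm (∼y), ← add_sub_eq_inf_neg, inf_comm, ← e1, e3, tsub_tsub, hc, add_assoc]
  have h2 : ∼d ≤ ∼c + ∼x := by
    rw [← tsub_le_iff_right, neg_sub_neg]
    exact hc'.ge
  rw [← le_zero_iff, h1, tsub_tsub]
  calc ∼c + ∼y - (∼c + ∼x) ≤ ∼c + ∼y - ∼d := tsub_le_tsub_left h2 _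
    _ ≤ 0 := by
      rw [hd', tsub_le_iff_right, zero_add, add_comm]
      gcongr
      exact tsub_le_self

/-- `a ⊕ ·` is the upper adjoint of `· ⊖ a`, hence preserves meets. -/
theorem add_inf (a x y : A) : a + x ⊓ y = (a + x) ⊓ (a + y) := by
  refine _root_.le_antisymm (le_inf (by gcongr; exact inf_le_left) (by gcongr; exact inf_le_right)) ?_
  rw [← tsub_le_iff_left]
  exact le_inf (tsub_le_iff_left.2 inf_le_left) (tsub_le_iff_left.2 inf_le_right)

theorem inf_add_eq_zero {s t t' : A} (h : s ⊓ t = 0) (h' : s ⊓ t' = 0) : s ⊓ (t + t') = 0 := by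
  have h1 : s ⊓ (t + t') ≤ t' := by
    calc s ⊓ (t + t') ≤ (t' + s) ⊓ (t' + t) := by
          rw [add_comm t]; exact inf_le_inf_right _ le_add_self
      _ = t' := by rw [← add_inf, h, add_zero]
  exact le_zero_iff.1 ((le_inf inf_le_left h1).trans h'.le)

theorem inf_nsmul_eq_zero {s t : A} (h : s ⊓ t = 0) (n : ℕ) : s ⊓ n • t = 0 := by
  induction n with
  | zero => simp
  | succ n ih => rw [succ_nsmul]; exact inf_add_eq_zero ih h

theorem nsmul_inf_nsmul_eq_zero {s t : A} (h : s ⊓ t = 0) (m n : ℕ) : m • s ⊓ n • t = 0 := by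
  rw [inf_comm]
  exact inf_nsmul_eq_zero (by rw [inf_comm]; exact inf_nsmul_eq_zero h n) m

/-! ### Prime ideals and quotients that are chains -/

/-- Ideals: nonempty downward closed sets that are closed under `⊕`. -/
structure IsIdeal (P : Set A) : Prop where
  zero_mem : 0 ∈ P
  add_mem : ∀ x ∈ P, ∀ y ∈ P, x + y ∈ P
  mem_of_le : ∀ x y, x ≤ y → y ∈ P → x ∈ P

theorem IsIdeal.adjoin {P : Set A} (hP : IsIdeal P) (s : A) :
    IsIdeal {z | ∃ p ∈ P, ∃ n : ℕ, z ≤ p + n • s} where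
  zero_mem := ⟨0, hP.zero_mem, 0, zero_le⟩
  add_mem := by
    rintro x ⟨p, hp, m, hx⟩ y ⟨q, hq, n, hy⟩
    refine ⟨p + q, hP.add_mem p hp q hq, m + n, ?_⟩
    rw [add_nsmul, add_add_add_comm]
    exact add_le_add hx hy
  mem_of_le := by
    rintro x y hxy ⟨p, hp, n, hy⟩
    exact ⟨p, hp, n, hxy.trans hy⟩

/-- Every nonzero element is avoided by some prime ideal. -/
theorem exists_prime_ideal {a : A} (ha : a ≠ 0) :
    ∃ P : Set A, IsIdeal P ∧ a ∉ P ∧ ∀ s t : A, s ⊓ t = 0 → s ∈ P ∨ t ∈ P := by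
  obtain ⟨P, hmax⟩ := zorn_subset {P : Set A | IsIdeal P ∧ a ∉ P} (by
    intro c hc hchain
    rcases c.eq_empty_or_nonempty with rfl | ⟨Q, hQ⟩
    · refine ⟨{0}, ⟨⟨rfl, ?_, ?_⟩, ha⟩, by simp⟩
      · rintro x rfl y rfl
        exact add_zero _
      · rintro x y hxy rfl
        exact le_zero_iff.1 hxy
    · refine ⟨⋃₀ c, ⟨⟨⟨Q, hQ, (hc hQ).1.zero_mem⟩, ?_, ?_⟩, ?_⟩, fun s hs => Set.subset_sUnion_of_mem hs⟩
      · rintro x ⟨R, hR, hx⟩ y ⟨T, hT, hy⟩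
        rcases hchain.total hR hT with h | h
        · exact ⟨T, hT, (hc hT).1.add_mem x (h hx) y hy⟩
        · exact ⟨R, hR, (hc hR).1.add_mem x hx y (h hy)⟩
      · rintro x y hxy ⟨R, hR, hy⟩
        exact ⟨R, hR, (hc hR).1.mem_of_le x y hxy hy⟩
      · rintro ⟨R, hR, h⟩
        exact (hc hR).2 h)
  obtain ⟨hP, haP⟩ := hmax.prop
  -- Otherwise the ideal generated by `P` and `s` still omits `a`, against maximality.
  have key : ∀ s ∉ P, ∃ p ∈ P, ∃ n : ℕ, a ≤ p + n • s := by
    intro s hs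
    by_contra hcon
    have hsub : P ⊆ {z | ∃ p ∈ P, ∃ n : ℕ, z ≤ p + n • s} :=
      fun p hp => ⟨p, hp, 0, le_self_add⟩
    exact hs (hmax.le_of_ge ⟨hP.adjoin s, hcon⟩ hsub
      ⟨0, hP.zero_mem, 1, by rw [one_nsmul]; exact le_add_self⟩)
  refine ⟨P, hP, haP, fun s t hst => ?_⟩
  by_contra! hcon
  obtain ⟨p, hp, m, h1⟩ := key s hcon.1
  obtain ⟨q, hq, n, h2⟩ := key t hcon.2
  refine haP (hP.mem_of_le a (p + q) ?_ (hP.add_mem p hp q hq))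
  -- Over the common summand `p ⊕ q` the meet distributes, and multiples of orthogonal elements are
  -- orthogonal.
  calc a ≤ (p + q + m • s) ⊓ (p + q + n • t) := le_inf
        (h1.trans (by gcongr; exact le_self_add)) (h2.trans (by gcongr; exact le_add_self))
    _ = p + q := by rw [← add_inf, nsmul_inf_nsmul_eq_zero hst, add_zero]

/-- The congruence of an ideal. -/
abbrev IsIdeal.setoid {P : Set A} (hP : IsIdeal P) : Setoid A where
  r x y := x - y ∈ P ∧ y - x ∈ P
  iseqv :=
    { refl x := by simp [hP.zero_mem]
      symm h := ⟨h.2, h.1⟩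
      trans {x y z} h h' :=
        ⟨hP.mem_of_le _ _ tsub_le_tsub_add_tsub (hP.add_mem _ h.1 _ h'.1),
          hP.mem_of_le _ _ tsub_le_tsub_add_tsub (hP.add_mem _ h'.2 _ h.2)⟩ }

/-- The quotient of an MV-algebra by an ideal. -/
abbrev IsIdeal.quotient {P : Set A} (hP : IsIdeal P) : MVAlgebra (Quotient hP.setoid) where
  oplus := Quotient.map₂ oplus (by
    intro x x' hx y y' hy
    exact ⟨hP.mem_of_le _ _ add_tsub_add_le_tsub_add_tsub (hP.add_mem _ hx.1 _ hy.1),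
      hP.mem_of_le _ _ add_tsub_add_le_tsub_add_tsub (hP.add_mem _ hx.2 _ hy.2)⟩)
  neg := Quotient.map neg (by
    rintro x y ⟨h1, h2⟩
    exact ⟨by rwa [neg_sub_neg], by rwa [neg_sub_neg]⟩)
  zero := Quotient.mk _ zero
  oplus_comm := by
    rintro ⟨x⟩ ⟨y⟩
    exact congrArg (Quotient.mk _) (oplus_comm x y)
  oplus_assoc := by
    rintro ⟨x⟩ ⟨y⟩ ⟨z⟩
    exact congrArg (Quotient.mk _) (oplus_assoc x y z)
  oplus_zero := by
    rintro ⟨x⟩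
    exact congrArg (Quotient.mk _) (oplus_zero x)
  neg_neg := by
    rintro ⟨x⟩
    exact congrArg (Quotient.mk _) (MVAlgebra.neg_neg x)
  oplus_one := by
    rintro ⟨x⟩
    exact congrArg (Quotient.mk _) (oplus_one x)
  lukasiewicz := by
    rintro ⟨x⟩ ⟨y⟩
    exact congrArg (Quotient.mk _) (lukasiewicz x y)

/-- Any two distinct elements of an MV-algebra are separated by a homomorphism to an MV-chain. -/
theorem exists_chain_separating {x y : A} (hxy : x ≠ y) :
    ∃ (C : Type u) (_ : MVAlgebra C) (π : A → C),
      IsLinearlyOrdered C ∧ IsHomOn Set.univ π ∧ π x ≠ π y := by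
  obtain ⟨a, ha, ha'⟩ : ∃ a : A, a ≠ 0 ∧ (a = x - y ∨ a = y - x) := by
    by_contra! hcon
    refine hxy (_root_.le_antisymm ?_ ?_) <;> rw [← tsub_eq_zero_iff_le] <;> by_contra h
    · exact (hcon _ h).1 rfl
    · exact (hcon _ h).2 rfl
  obtain ⟨P, hP, haP, hprime⟩ := exists_prime_ideal ha
  let _ := hP.quotient
  refine ⟨Quotient hP.setoid, hP.quotient, Quotient.mk _, ?_, ⟨fun _ _ _ _ => rfl, fun _ _ => rfl, rfl⟩, ?_⟩
  -- The distance from `¬s ⊕ t` to `1` is `¬(¬s ⊕ t) = s ⊖ t`.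
  · have key : ∀ s t : A, s - t ∈ P → @le _ hP.quotient (Quotient.mk _ s) (Quotient.mk _ t) := by
      intro s t h
      refine Quotient.sound (s := hP.setoid) (a := ∼s + t) (b := one A) ⟨?_, ?_⟩
      · rw [tsub_eq_zero_of_le (le_one _)]
        exact hP.zero_mem
      · rwa [← neg_eq_one_sub]
    rintro ⟨s⟩ ⟨t⟩
    exact (hprime _ _ (sub_inf_sub s t)).imp (key s t) (key t s)
  · intro h
    have h' := Quotient.exact h
    rcases ha' with rfl | rfl
    exacts [haP h'.1, haP h'.2]

/-! ### The linearly ordered group of a chain -/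

theorem ne_one_of_le {x y : A} (h : x ≤ y) (hy : y ≠ one A) : x ≠ one A := by
  rintro rfl
  exact hy (_root_.le_antisymm (le_one _) h)

theorem neg_le_of_add_eq_one {x y : A} (h : x + y = one A) : ∼x ≤ y := by
  rwa [le_iff_neg_add, MVAlgebra.neg_neg]

theorem sub_neg_comm (x y : A) : x - ∼y = y - ∼x := by
  rw [sub_def, sub_def, add_comm]

/-- In a chain, sums below `1` are cancellative. -/
theorem add_sub_cancel_of_ne_one (hA : IsLinearlyOrdered A) {x y : A} (h : x + y ≠ one A) :
    x + y - x = y := by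
  rw [add_sub_eq_inf_neg, inf_eq_left]
  refine (hA y (∼x)).resolve_right fun h' => h ?_
  rwa [le, MVAlgebra.neg_neg] at h'

/-- Read `x ⊖ ¬y` as `x + y - 1`, the remainder after a carry; both sides are then `a + b + c - 1`.
Formally, split `¬b` as `c ⊕ (¬b ⊖ c)` and cancel `c`. -/
theorem carry_comm_aux (hA : IsLinearlyOrdered A) {a b c : A} (hac : a + c ≠ one A)
    (hbc : b + c ≠ one A) (h : a + (b + c) = one A) : a - ∼(b + c) = b - ∼(a + c) := by
  have h1 : c ≤ ∼b := by
    refine (hA c (∼b)).resolve_right fun h' => hbc ?_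
    rwa [le, MVAlgebra.neg_neg] at h'
  have h2 : ∼b - c ≤ a := by
    rw [tsub_le_iff_right]
    apply neg_le_of_add_eq_one
    rw [add_left_comm, h]
  have h3 : ∼b = c + (∼b - c) := by rw [add_comm, sub_add_cancel_of_le h1]
  rw [sub_neg_comm b, h3, ← tsub_tsub, add_comm a, add_sub_cancel_of_ne_one hA (by rwa [add_comm]),
    sub_def (∼b), MVAlgebra.neg_neg]

/-- Again `a + b + c - 1` on both sides, the carry now occurring already in `a + c`: write `c` as
`¬a ⊕ (a ⊖ ¬c)` and cancel `¬a`. -/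
theorem carry_comm_aux' (hA : IsLinearlyOrdered A) {a b c : A} (hac : a + c = one A)
    (hbc : b + c ≠ one A) : a - ∼(b + c) = b + (a - ∼c) := by
  have h1 : c = ∼a + (a - ∼c) := by
    rw [sub_neg_comm, add_comm, sub_add_cancel_of_le (neg_le_of_add_eq_one hac)]
  have h2 : b + c = ∼a + (b + (a - ∼c)) := by
    conv_lhs => rw [h1]
    ac_rfl
  rw [sub_neg_comm, h2, add_sub_cancel_of_ne_one hA (h2 ▸ hbc)]

variable (A) in
/-- Elements `floor + frac` of the ordered group of a chain, with `frac` in `A \ {1}`. -/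
@[ext] structure ChainGroup where
  floor : ℤ
  frac : A
  frac_ne_one : frac ≠ one A

namespace ChainGroup

open scoped Classical in
/-- Addition with carry. -/
noncomputable abbrev add (x y : ChainGroup A) : ChainGroup A :=
  if h : x.frac + y.frac = one A then
    ⟨x.floor + y.floor + 1, x.frac - ∼y.frac, ne_one_of_le tsub_le_self x.frac_ne_one⟩
  else ⟨x.floor + y.floor, x.frac + y.frac, h⟩

theorem add_of_eq {x y : ChainGroup A} (h : x.frac + y.frac = one A) :
    (add x y).floor = x.floor + y.floor + 1 ∧ (add x y).frac = x.frac - ∼y.frac := by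
  simp [add, h]

theorem add_of_ne {x y : ChainGroup A} (h : x.frac + y.frac ≠ one A) :
    (add x y).floor = x.floor + y.floor ∧ (add x y).frac = x.frac + y.frac := by
  simp [add, h]

theorem add_comm' (x y : ChainGroup A) : add x y = add y x := by
  by_cases h : x.frac + y.frac = one A
  · have h1 := add_of_eq h
    have h2 := add_of_eq ((add_comm _ _).trans h)
    ext
    · rw [h1.1, h2.1, add_comm x.floor]
    · rw [h1.2, h2.2, sub_neg_comm]
  · have h1 := add_of_ne h
    have h2 := add_of_ne (ne_of_eq_of_ne (add_comm _ _) h)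
    ext
    · rw [h1.1, h2.1, add_comm x.floor]
    · rw [h1.2, h2.2, add_comm]

theorem add_left_comm_aux (hA : IsLinearlyOrdered A) {x y z : ChainGroup A}
    (hx : x.frac + z.frac = one A) (hy : y.frac + z.frac ≠ one A) :
    add x (add y z) = add y (add x z) := by
  have h1 := add_of_eq hx
  have h2 := add_of_ne hy
  have key := carry_comm_aux' hA hx hy
  have h3 : x.frac + (add y z).frac = one A := by
    rw [h2.2, add_left_comm, hx, add_one_eq_one]
  have h4 : y.frac + (add x z).frac ≠ one A := by
    rw [h1.2, ← key]
    exact ne_one_of_le tsub_le_self x.frac_ne_one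
  have h3' := add_of_eq h3
  have h4' := add_of_ne h4
  ext
  · rw [h3'.1, h4'.1, h1.1, h2.1]
    ring
  · rw [h3'.2, h4'.2, h1.2, h2.2, key]

/-- With commutativity this gives associativity, and it is symmetric in `x` and `y`; the cases are
whether `x + z` and `y + z` carry. -/
theorem add_left_comm' (hA : IsLinearlyOrdered A) (x y z : ChainGroup A) :
    add x (add y z) = add y (add x z) := by
  by_cases hx : x.frac + z.frac = one A <;> by_cases hy : y.frac + z.frac = one A
  · have h1 := add_of_eq hx
    have h2 := add_of_eq hy
    have e1 := sub_add_cancel_of_le (neg_le_of_add_eq_one ((add_comm _ _).trans hx))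
    have e2 := sub_add_cancel_of_le (neg_le_of_add_eq_one ((add_comm _ _).trans hy))
    have e : x.frac + (y.frac - ∼z.frac) = y.frac + (x.frac - ∼z.frac) := by
      conv_lhs => rw [← e1]
      conv_rhs => rw [← e2]
      ac_rfl
    by_cases h : x.frac + (y.frac - ∼z.frac) = one A
    · have h3 := add_of_eq (x := x) (y := add y z) (by rw [h2.2, h])
      have h4 := add_of_eq (x := y) (y := add x z) (by rw [h1.2, ← e, h])
      ext
      · rw [h3.1, h4.1, h1.1, h2.1]
        ring
      · rw [h3.2, h4.2, h1.2, h2.2]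
        simp only [sub_def, MVAlgebra.neg_neg]
        rw [add_left_comm]
    · have h3 := add_of_ne (x := x) (y := add y z) (by rwa [h2.2])
      have h4 := add_of_ne (x := y) (y := add x z) (by rwa [h1.2, ← e])
      ext
      · rw [h3.1, h4.1, h1.1, h2.1]
        ring
      · rw [h3.2, h4.2, h1.2, h2.2, e]
  · exact add_left_comm_aux hA hx hy
  · exact (add_left_comm_aux hA hy hx).symm
  · have h1 := add_of_ne hx
    have h2 := add_of_ne hy
    by_cases h : x.frac + (y.frac + z.frac) = one A
    · have h3 := add_of_eq (x := x) (y := add y z) (by rw [h2.2, h])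
      have h4 := add_of_eq (x := y) (y := add x z) (by rw [h1.2, add_left_comm, h])
      ext
      · rw [h3.1, h4.1, h1.1, h2.1]
        ring
      · rw [h3.2, h4.2, h1.2, h2.2, carry_comm_aux hA hx hy h]
    · have h3 := add_of_ne (x := x) (y := add y z) (by rwa [h2.2])
      have h4 := add_of_ne (x := y) (y := add x z) (by rwa [h1.2, add_left_comm])
      ext
      · rw [h3.1, h4.1, h1.1, h2.1]
        ring
      · rw [h3.2, h4.2, h1.2, h2.2, add_left_comm]

theorem zero_ne_one [Nontrivial A] : (0 : A) ≠ one A := by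
  intro h
  obtain ⟨x, hx⟩ := exists_ne (0 : A)
  exact hx (le_zero_iff.1 (h ▸ le_one x))

open scoped Classical in
/-- Negation in the group of a chain. -/
noncomputable abbrev opp [Nontrivial A] (x : ChainGroup A) : ChainGroup A :=
  if h : x.frac = 0 then ⟨-x.floor, 0, zero_ne_one⟩
  else ⟨-x.floor - 1, ∼x.frac, fun h' => h (by
    rw [← MVAlgebra.neg_neg x.frac, h', neg_one_eq_zero])⟩

noncomputable instance : Add (ChainGroup A) := ⟨add⟩

noncomputable instance [Nontrivial A] : Zero (ChainGroup A) := ⟨⟨0, 0, zero_ne_one⟩⟩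

noncomputable instance [Nontrivial A] : Neg (ChainGroup A) := ⟨opp⟩

/-- The group of a chain. -/
noncomputable abbrev addCommGroup [Nontrivial A] (hA : IsLinearlyOrdered A) :
    AddCommGroup (ChainGroup A) where
  add_assoc x y z := by
    change add (add x y) z = add x (add y z)
    rw [add_comm', add_left_comm' hA, add_comm' z]
  add_comm := add_comm'
  zero_add x := by
    have h : (0 : A) + x.frac ≠ one A := by
      rw [zero_add]
      exact x.frac_ne_one
    have := add_of_ne (x := ⟨0, 0, zero_ne_one⟩) h
    ext
    · exact this.1.trans (zero_add _)
    · exact this.2.trans (zero_add _)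
  add_zero x := by
    have h : x.frac + (0 : A) ≠ one A := by
      rw [add_zero]
      exact x.frac_ne_one
    have := add_of_ne (y := ⟨0, 0, zero_ne_one⟩) h
    ext
    · exact this.1.trans (add_zero _)
    · exact this.2.trans (add_zero _)
  neg_add_cancel x := by
    change add (opp x) x = ⟨0, 0, zero_ne_one⟩
    by_cases h : x.frac = 0
    · have e : opp x = ⟨-x.floor, 0, zero_ne_one⟩ := dif_pos h
      rw [e]
      have := add_of_ne (x := ⟨-x.floor, 0, zero_ne_one⟩) (y := x) (by
        rw [h, add_zero]; exact zero_ne_one)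
      ext
      · simp [this.1]
      · simp [this.2, h]
    · have e1 : (opp x).floor = -x.floor - 1 := by simp [opp, h]
      have e2 : (opp x).frac = ∼x.frac := by simp [opp, h]
      have := add_of_eq (x := opp x) (y := x) (by rw [e2, neg_add_self_eq_one])
      ext
      · rw [this.1, e1]
        ring
      · rw [this.2, e2, tsub_self]
  nsmul := nsmulRec
  zsmul := zsmulRec

/-- The lexicographic order on the group of a chain. -/
noncomputable abbrev linearOrder (hA : IsLinearlyOrdered A) : LinearOrder (ChainGroup A) where
  le x y := x.floor < y.floor ∨ x.floor = y.floor ∧ x.frac ≤ y.frac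
  le_refl x := Or.inr ⟨rfl, le_rfl⟩
  le_trans x y z := by
    rintro (h | ⟨h, h'⟩) (k | ⟨k, k'⟩)
    · exact Or.inl (h.trans k)
    · exact Or.inl (k ▸ h)
    · exact Or.inl (h ▸ k)
    · exact Or.inr ⟨h.trans k, h'.trans k'⟩
  le_antisymm x y := by
    rintro (h | ⟨h, h'⟩) (k | ⟨k, k'⟩)
    · exact absurd h k.asymm
    · exact absurd h k.not_gt
    · exact absurd k h.not_gt
    · exact ChainGroup.ext h (_root_.le_antisymm h' k')
  le_total x y := by
    rcases lt_trichotomy x.floor y.floor with h | h | h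
    · exact Or.inl (Or.inl h)
    · exact (hA x.frac y.frac).imp (fun k => Or.inr ⟨h, k⟩) (fun k => Or.inr ⟨h.symm, k⟩)
    · exact Or.inr (Or.inl h)
  toDecidableLE := Classical.decRel _

theorem isOrderedAddMonoid [Nontrivial A] (hA : IsLinearlyOrdered A) :
    @IsOrderedAddMonoid (ChainGroup A) (addCommGroup hA).toAddCommMonoid
      (linearOrder hA).toPreorder := by
  let _ := addCommGroup hA
  let _ := linearOrder hA
  refine { add_le_add_left := fun x y hxy z => ?_ }
  change (add x z).floor < (add y z).floor ∨
    (add x z).floor = (add y z).floor ∧ (add x z).frac ≤ (add y z).frac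
  have hmono : x.frac ≤ y.frac → x.frac + z.frac = one A → y.frac + z.frac = one A :=
    fun h h' => by_contra fun h'' => ne_one_of_le (add_le_add_left h _) h'' h'
  by_cases hx : x.frac + z.frac = one A <;> by_cases hy : y.frac + z.frac = one A
  · rw [(add_of_eq hx).1, (add_of_eq hx).2, (add_of_eq hy).1, (add_of_eq hy).2]
    rcases hxy with h | ⟨h, h'⟩
    · left; linarith
    · right; exact ⟨by rw [h], tsub_le_tsub_right h' _⟩
  · rw [(add_of_eq hx).1, (add_of_eq hx).2, (add_of_ne hy).1, (add_of_ne hy).2]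
    rcases hxy with h | ⟨h, h'⟩
    -- The carry can at most equalize the floors; then the remainder `x ⊖ ¬z = z ⊖ ¬x` is at most
    -- `z`, hence at most `y ⊕ z`.
    · rcases (Int.add_one_le_of_lt h).lt_or_eq with h | h
      · left; linarith
      · right
        refine ⟨by rw [← h]; ring, ?_⟩
        rw [sub_neg_comm]
        exact tsub_le_self.trans le_add_self
    · exact absurd (hmono h' hx) hy
  · rw [(add_of_ne hx).1, (add_of_eq hy).1]
    left
    rcases hxy with h | ⟨h, h'⟩ <;> linarith
  · rw [(add_of_ne hx).1, (add_of_ne hx).2, (add_of_ne hy).1, (add_of_ne hy).2]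
    rcases hxy with h | ⟨h, h'⟩
    · left; linarith
    · right; exact ⟨by rw [h], add_le_add_left h' _⟩

end ChainGroup

/-- Every nontrivial chain is the unit interval of a linearly ordered abelian group. -/
theorem exists_group_of_chain [Nontrivial A] (hA : IsLinearlyOrdered A) :
    ∃ (G : Type u) (_ : AddCommGroup G) (_ : LinearOrder G) (_ : IsOrderedAddMonoid G)
      (ι : A → G),
      ι zero = 0 ∧ (∀ x y, le x y → x ≠ y → ι x < ι y) ∧
      (∀ x, ι (neg x) + ι x = ι (one A)) ∧
      ∀ x y, oplus x y ≠ one A → ι (oplus x y) = ι x + ι y := by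
  classical
  let _ := ChainGroup.addCommGroup hA
  let _ := ChainGroup.linearOrder hA
  -- The element 1 is no admissible fractional part, so it becomes integer part 1.
  let ι : A → ChainGroup A := fun a =>
    if h : a = one A then ⟨1, 0, ChainGroup.zero_ne_one⟩ else ⟨0, a, h⟩
  have ι_one : ι (one A) = ⟨1, 0, ChainGroup.zero_ne_one⟩ := dif_pos rfl
  have ι_ne : ∀ {a} (h : a ≠ one A), ι a = ⟨0, a, h⟩ := fun h => dif_neg h
  have ι_zero : ι (0 : A) = 0 := ι_ne ChainGroup.zero_ne_one
  refine ⟨ChainGroup A, _, _, ChainGroup.isOrderedAddMonoid hA, ι, ι_zero, ?_, ?_, ?_⟩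
  · intro x y hxy hne
    have hx : x ≠ one A := by
      rintro rfl
      exact hne (_root_.le_antisymm hxy (le_one y))
    rw [ι_ne hx]
    by_cases hy : y = one A
    · rw [hy, ι_one]
      refine lt_of_le_of_ne (Or.inl zero_lt_one) fun h => ?_
      exact zero_ne_one (congrArg ChainGroup.floor h)
    · rw [ι_ne hy]
      exact lt_of_le_of_ne (Or.inr ⟨rfl, hxy⟩) fun h => hne (congrArg ChainGroup.frac h)
  · intro x
    by_cases h1 : x = one A
    · rw [h1, neg_one_eq_zero, ι_zero, zero_add]
    by_cases h0 : x = 0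
    · rw [h0, neg_zero_eq_one, ι_zero, add_zero]
    have h2 : ∼x ≠ one A := fun h => h0 (by rw [← MVAlgebra.neg_neg x, h, neg_one_eq_zero])
    rw [ι_ne h1, ι_ne h2, ι_one]
    have := ChainGroup.add_of_eq (x := ⟨0, ∼x, h2⟩) (y := ⟨0, x, h1⟩) (neg_add_self_eq_one x)
    exact ChainGroup.ext this.1 (this.2.trans (tsub_self _))
  · intro x y hxy
    have hx : x ≠ one A := ne_one_of_le (le_self_add (a := x) (b := y)) hxy
    have hy : y ≠ one A := ne_one_of_le (le_add_self (a := y) (b := x)) hxy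
    rw [ι_ne hx, ι_ne hy, ι_ne hxy]
    have := ChainGroup.add_of_ne (x := ⟨0, x, hx⟩) (y := ⟨0, y, hy⟩) hxy
    exact (ChainGroup.ext this.1 this.2).symm

end Order

end MVAlgebra

/-! ### Rational solutions of finite systems of strict inequalities -/

/-- A transposition theorem: finitely many strict linear inequalities with integer coefficients
that hold in a linearly ordered abelian group have a rational solution. -/
theorem exists_rat_solution {G : Type*} [AddCommGroup G] [LinearOrder G] [IsOrderedAddMonoid G]
    (n : ℕ) (g : Fin n → G) (C : Finset (Fin n → ℤ)) (hC : ∀ c ∈ C, 0 < ∑ i, c i • g i) :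
    ∃ q : Fin n → ℚ, ∀ c ∈ C, 0 < ∑ i, (c i : ℚ) * q i := by
  classical
  induction n with
  | zero =>
    refine ⟨0, fun c hc => ?_⟩
    simpa using hC c hc
  | succ n ih =>
    let P := C.filter fun c => 0 < c 0
    let N := C.filter fun c => c 0 < 0
    let Z := C.filter fun c => c 0 = 0
    -- Fourier–Motzkin elimination: the positive combination of a row from `P` and one from `N` in
    -- which variable 0 cancels.
    let comb : (Fin (n + 1) → ℤ) × (Fin (n + 1) → ℤ) → Fin n → ℤ :=
      fun p i => -p.2 0 * p.1 i.succ + p.1 0 * p.2 i.succ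
    obtain ⟨q, hq⟩ := ih (fun i => g i.succ) (Z.image (fun c i => c i.succ) ∪ (P ×ˢ N).image comb) (by
      intro c hc
      rcases Finset.mem_union.1 hc with hc | hc
      · obtain ⟨d, hd, rfl⟩ := Finset.mem_image.1 hc
        obtain ⟨hd, h0⟩ := Finset.mem_filter.1 hd
        have := hC d hd
        rwa [Fin.sum_univ_succ, h0, zero_smul, zero_add] at this
      · obtain ⟨⟨c, d⟩, hcd, rfl⟩ := Finset.mem_image.1 hc
        obtain ⟨hc, hd⟩ := Finset.mem_product.1 hcd
        obtain ⟨hc, hc0⟩ := Finset.mem_filter.1 hc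
        obtain ⟨hd, hd0⟩ := Finset.mem_filter.1 hd
        have h1 := zsmul_pos (hC c hc) (neg_pos.2 hd0)
        have h2 := zsmul_pos (hC d hd) hc0
        have h3 := add_pos h1 h2
        simp only [Fin.sum_univ_succ, smul_add, Finset.smul_sum, smul_smul] at h3
        simp only [comb, add_smul, Finset.sum_add_distrib]
        convert h3 using 1
        rw [add_add_add_comm, ← add_smul]
        simp [mul_comm])
    -- Rows in `P` bound variable 0 from below, rows in `N` from above; the combined rows say that
    -- these bounds are compatible.
    have hlohi : ∀ x ∈ P.image (fun c => -(∑ i : Fin n, (c i.succ : ℚ) * q i) / c 0),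
        ∀ y ∈ N.image (fun c => -(∑ i : Fin n, (c i.succ : ℚ) * q i) / c 0), x < y := by
      intro x hx y hy
      obtain ⟨c, hc, rfl⟩ := Finset.mem_image.1 hx
      obtain ⟨d, hd, rfl⟩ := Finset.mem_image.1 hy
      have h := hq (comb (c, d)) (Finset.mem_union_right _ (Finset.mem_image_of_mem _
        (Finset.mem_product.2 ⟨hc, hd⟩)))
      have hc0 : (0 : ℚ) < c 0 := by exact_mod_cast (Finset.mem_filter.1 hc).2
      have hd0 : (d 0 : ℚ) < 0 := by exact_mod_cast (Finset.mem_filter.1 hd).2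
      simp only [comb, Int.cast_add, Int.cast_mul, Int.cast_neg, add_mul, mul_assoc,
        Finset.sum_add_distrib, ← Finset.mul_sum] at h
      rw [div_lt_iff₀ hc0, div_mul_eq_mul_div, lt_div_iff_of_neg hd0]
      linarith
    obtain ⟨r, hr1, hr2⟩ := Order.exists_between_finsets _ _ hlohi
    refine ⟨Fin.cons r q, fun c hc => ?_⟩
    rw [Fin.sum_univ_succ]
    simp only [Fin.cons_zero, Fin.cons_succ]
    rcases lt_trichotomy (c 0) 0 with h0 | h0 | h0
    · have := hr2 _ (Finset.mem_image_of_mem _ (Finset.mem_filter.2 ⟨hc, h0⟩))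
      rw [lt_div_iff_of_neg (by exact_mod_cast h0)] at this
      linarith
    · have := hq _ (Finset.mem_union_left _ (Finset.mem_image_of_mem _ (Finset.mem_filter.2 ⟨hc, h0⟩)))
      simpa [h0] using this
    · have := hr1 _ (Finset.mem_image_of_mem _ (Finset.mem_filter.2 ⟨hc, h0⟩))
      rw [div_lt_iff₀ (by exact_mod_cast h0)] at this
      linarith

/-- For a finite subset `T` of a linearly ordered abelian group there is an additive function from
the subgroup generated by `T` to `ℚ` that is positive on the positive elements of `T`. -/
theorem exists_additive_pos {G : Type*} [AddCommGroup G] [LinearOrder G] [IsOrderedAddMonoid G]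
    (T : Finset G) :
    ∃ φ : Submodule.span ℤ (T : Set G) →ₗ[ℤ] ℚ, ∀ t (ht : t ∈ T), 0 < t →
      0 < φ ⟨t, Submodule.subset_span ht⟩ := by
  classical
  have : Module.Finite ℤ (Submodule.span ℤ (T : Set G)) :=
    Module.Finite.iff_fg.2 (Submodule.fg_span T.finite_toSet)
  -- The span is finitely generated and torsion-free over `ℤ`, hence free.
  let b := Module.finBasis ℤ (Submodule.span ℤ (T : Set G))
  let e : {t // t ∈ T} → Fin _ → ℤ := fun t => b.repr ⟨t, Submodule.subset_span t.2⟩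
  obtain ⟨q, hq⟩ := exists_rat_solution _ (fun i => (b i : G))
    ((T.attach.filter fun t => 0 < t.1).image e) (by
      intro c hc
      obtain ⟨⟨t, ht⟩, h, rfl⟩ := Finset.mem_image.1 hc
      have h1 := congrArg Subtype.val (b.sum_repr ⟨t, Submodule.subset_span ht⟩)
      simp only [Submodule.coe_sum, Submodule.coe_smul] at h1
      rw [h1]
      exact (Finset.mem_filter.1 h).2)
  refine ⟨b.constr ℤ q, fun t ht h0 => ?_⟩
  have := hq _ (Finset.mem_image_of_mem e
    (Finset.mem_filter.2 ⟨Finset.mem_attach T ⟨t, ht⟩, h0⟩))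
  simpa [Module.Basis.constr_apply_fintype, e] using this

/-! ### Finite parts inside the rational unit interval and its powers -/

namespace MVAlgebra

/-- A finite part of a nontrivial chain is faithfully represented in `ℚ ∩ [0, 1]`. -/
theorem exists_rat_of_chain {A : Type u} [MVAlgebra A] [Nontrivial A] (hA : IsLinearlyOrdered A)
    (S : Finset A) : ∃ f : A → RatUnit, IsHomOn (S : Set A) f ∧ Set.InjOn f S := by
  classical
  obtain ⟨G, _, _, _, ι, ι_zero, ι_lt, ι_neg, ι_add⟩ := exists_group_of_chain hA
  have le_one' : ∀ x : A, le x (one A) := fun x => oplus_one _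
  have zero_le' : ∀ x : A, le zero x := fun x => (oplus_comm _ _).trans (oplus_one x)
  let S' : Finset A := {zero, one A} ∪ S ∪ S.image neg ∪ (S ×ˢ S).image fun p => oplus p.1 p.2
  -- Positivity on the differences is what preserves strict inequalities.
  let T : Finset G := S'.image ι ∪ (S' ×ˢ S').image fun p => ι p.2 - ι p.1
  obtain ⟨φ, hφ⟩ := exists_additive_pos T
  have hmem : ∀ x ∈ S', ι x ∈ Submodule.span ℤ (T : Set G) := fun x hx =>
    Submodule.subset_span (Finset.mem_union_left _ (Finset.mem_image_of_mem ι hx))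
  let v : A → ℚ := fun x => if h : ι x ∈ Submodule.span ℤ (T : Set G) then φ ⟨ι x, h⟩ else 0
  have hv : ∀ x (h : x ∈ S'), v x = φ ⟨ι x, hmem x h⟩ := fun x h => dif_pos (hmem x h)
  have v_lt : ∀ x ∈ S', ∀ y ∈ S', le x y → x ≠ y → v x < v y := by
    intro x hx y hy hxy hne
    have h := hφ (ι y - ι x) (Finset.mem_union_right _
      (Finset.mem_image_of_mem (fun p : A × A => ι p.2 - ι p.1) (Finset.mem_product.2 ⟨hx, hy⟩ : (x, y) ∈ _)))
      (sub_pos.2 (ι_lt x y hxy hne))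
    rw [hv x hx, hv y hy, ← sub_pos, ← map_sub]
    exact h
  have v_le : ∀ x ∈ S', ∀ y ∈ S', le x y → v x ≤ v y := by
    intro x hx y hy hxy
    by_cases h : x = y
    · rw [h]
    · exact (v_lt x hx y hy hxy h).le
  have v_add : ∀ x (_ : x ∈ S') y (_ : y ∈ S') z (_ : z ∈ S'), ι x + ι y = ι z → v x + v y = v z := by
    intro x hx y hy z hz h
    rw [hv x hx, hv y hy, hv z hz, ← map_add]
    congr 1
    exact Subtype.ext h
  have h0 : zero ∈ S' := by simp [S']
  have h1 : one A ∈ S' := by simp [S']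
  have hS : ∀ x ∈ S, x ∈ S' := fun x hx => by simp [S', hx]
  have hneg : ∀ x ∈ S, neg x ∈ S' := fun x hx =>
    Finset.mem_union_left _ (Finset.mem_union_right _ (Finset.mem_image_of_mem neg hx))
  have hadd : ∀ x ∈ S, ∀ y ∈ S, oplus x y ∈ S' := fun x hx y hy =>
    Finset.mem_union_right _ (Finset.mem_image_of_mem (fun p : A × A => oplus p.1 p.2)
      (Finset.mem_product.2 ⟨hx, hy⟩ : (x, y) ∈ _))
  have zero_ne : (zero : A) ≠ one A := by
    intro h
    obtain ⟨x, y, hxy⟩ := exists_pair_ne A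
    have key : ∀ z : A, z = one A := fun z => by rw [← oplus_zero z, h]; exact oplus_one z
    exact hxy ((key x).trans (key y).symm)
  have v_zero : v zero = 0 := by
    have := v_add zero h0 zero h0 zero h0 (by rw [ι_zero, add_zero])
    linarith
  have v_one : 0 < v (one A) := v_zero ▸ v_lt _ h0 _ h1 (zero_le' _) zero_ne
  have v_nonneg : ∀ x ∈ S', 0 ≤ v x := fun x hx => v_zero ▸ v_le _ h0 x hx (zero_le' x)
  have v_le_one : ∀ x ∈ S', v x ≤ v (one A) := fun x hx => v_le x hx _ h1 (le_one' x)
  have v_neg : ∀ x ∈ S, v (neg x) = v (one A) - v x := fun x hx =>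
    eq_sub_of_add_eq (v_add _ (hneg x hx) x (hS x hx) _ h1 (ι_neg x))
  -- Dividing by `v (one A)` sends the unit to 1; the projection changes nothing on `S'` and only
  -- makes `f` total.
  let f : A → RatUnit := fun x => Set.projIcc 0 1 zero_le_one (v x / v (one A))
  have hf : ∀ x ∈ S', (f x : ℚ) = v x / v (one A) := fun x hx => by
    have : v x / v (one A) ∈ Set.Icc (0 : ℚ) 1 :=
      ⟨div_nonneg (v_nonneg x hx) v_one.le, (div_le_one v_one).2 (v_le_one x hx)⟩
    simp only [f, Set.projIcc_of_mem _ this]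
  refine ⟨f, ⟨?_, ?_, ?_⟩, ?_⟩
  · intro x hx y hy
    apply Subtype.ext
    change _ = min ((f x : ℚ) + f y) 1
    rw [hf _ (hadd x hx y hy), hf x (hS x hx), hf y (hS y hy), ← add_div]
    -- If the sum is 1 then `¬x ≤ y`, so `v x + v y ≥ v 1` and the truncation gives 1.
    by_cases h : oplus x y = one A
    · have hle : le (neg x) y := by rwa [le, neg_neg]
      have := v_le _ (hneg x hx) y (hS y hy) hle
      rw [v_neg x hx] at this
      rw [h, div_self v_one.ne', min_eq_right]
      rw [le_div_iff₀ v_one]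
      linarith
    · rw [v_add x (hS x hx) y (hS y hy) _ (hadd x hx y hy) (ι_add x y h).symm, min_eq_left]
      exact (div_le_one v_one).2 (v_le_one _ (hadd x hx y hy))
  · intro x hx
    apply Subtype.ext
    change _ = 1 - (f x : ℚ)
    rw [hf _ (hneg x hx), hf x (hS x hx), v_neg x hx, sub_div, div_self v_one.ne']
  · apply Subtype.ext
    change _ = (0 : ℚ)
    rw [hf _ h0, v_zero, zero_div]
  · intro x hx y hy hxy
    have h := congrArg Subtype.val hxy
    rw [hf x (hS x hx), hf y (hS y hy), div_left_inj' v_one.ne'] at h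
    by_contra hne
    rcases hA x y with h' | h'
    · exact (v_lt x (hS x hx) y (hS y hy) h' hne).ne h
    · exact (v_lt y (hS y hy) x (hS x hx) h' (Ne.symm hne)).ne' h

/-- Two distinct elements are separated by a map to `ℚ ∩ [0, 1]` that is a homomorphism on a
given finite set. -/
theorem exists_rat_separating {A : Type u} [MVAlgebra A] (S : Finset A) {x y : A} (hxy : x ≠ y) :
    ∃ f : A → RatUnit, IsHomOn (S : Set A) f ∧ f x ≠ f y := by
  classical
  obtain ⟨C, _, π, hC, hπ, hne⟩ := exists_chain_separating hxy
  have : Nontrivial C := ⟨⟨_, _, hne⟩⟩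
  obtain ⟨g, hg, hinj⟩ := exists_rat_of_chain hC ((insert x (insert y S)).image π)
  have hS : ∀ z ∈ S, π z ∈ (((insert x (insert y S)).image π : Finset C) : Set C) := fun z hz =>
    Finset.mem_image_of_mem π (Finset.mem_insert_of_mem (Finset.mem_insert_of_mem hz))
  refine ⟨g ∘ π, ⟨fun a ha b hb => ?_, fun a ha => ?_, ?_⟩, fun h => hne (hinj ?_ ?_ h)⟩
  · simp only [Function.comp_apply]
    rw [hπ.map_oplus a trivial b trivial, hg.map_oplus _ (hS a ha) _ (hS b hb)]
  · simp only [Function.comp_apply]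
    rw [hπ.map_neg a trivial, hg.map_neg _ (hS a ha)]
  · simp only [Function.comp_apply]
    rw [hπ.map_zero, hg.map_zero]
  · exact Finset.mem_image_of_mem π (Finset.mem_insert_self _ _)
  · exact Finset.mem_image_of_mem π (Finset.mem_insert_of_mem (Finset.mem_insert_self _ _))

/-! ### Passage to ultraproducts -/

/-- An ultrafilter on the finite subsets of `A` that contains all cones. -/
noncomputable abbrev finsetUltrafilter (A : Type u) : Ultrafilter (Finset A) :=
  Ultrafilter.of Filter.atTop

theorem eventually_mem_finsetUltrafilter {A : Type u} (x : A) :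
    ∀ᶠ S : Finset A in (finsetUltrafilter A : Filter (Finset A)), x ∈ S :=
  Ultrafilter.of_le _ ((Filter.eventually_ge_atTop {x}).mono fun _ h =>
    h (Finset.mem_singleton_self x))

/-- The map to an ultraproduct that is given by a family of maps. -/
abbrev toUltraproduct {A : Type u} {I : Type v} (U : Ultrafilter I) {B : I → Type w}
    (f : ∀ i, A → B i) : A → Ultraproduct U B :=
  fun x => Quotient.mk _ fun i => f i x

theorem isHomOn_toUltraproduct {A : Type u} [MVAlgebra A] {B : Finset A → Type w}
    [∀ S, MVAlgebra (B S)] (f : ∀ S, A → B S) (hf : ∀ S : Finset A, IsHomOn (S : Set A) (f S)) :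
    IsHomOn Set.univ (toUltraproduct (finsetUltrafilter A) f) where
  map_oplus x _ y _ := Quotient.sound (by
    filter_upwards [eventually_mem_finsetUltrafilter x, eventually_mem_finsetUltrafilter y]
      with S hx hy using (hf S).map_oplus x hx y hy)
  map_neg x _ := Quotient.sound (by
    filter_upwards [eventually_mem_finsetUltrafilter x] with S hx using (hf S).map_neg x hx)
  map_zero := Quotient.sound (Filter.Eventually.of_forall fun S => (hf S).map_zero)

theorem toUltraproduct_ne {A : Type u} {B : Finset A → Type w} (f : ∀ S, A → B S) {x y : A}
    (h : ∀ S : Finset A, x ∈ S → y ∈ S → f S x ≠ f S y) :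
    toUltraproduct (finsetUltrafilter A) f x ≠ toUltraproduct (finsetUltrafilter A) f y := by
  intro heq
  have h1 : ∀ᶠ S : Finset A in (finsetUltrafilter A : Filter (Finset A)), f S x = f S y :=
    Quotient.exact heq
  obtain ⟨S, hS, hx, hy⟩ := (h1.and ((eventually_mem_finsetUltrafilter x).and
    (eventually_mem_finsetUltrafilter y))).exists
  exact h S hx hy hS

/-- Local embeddability implies embeddability into an ultraproduct. -/
theorem embedsInto_ultraproduct {A : Type u} [MVAlgebra A] {B : Finset A → Type w}
    [∀ S, MVAlgebra (B S)]
    (h : ∀ S : Finset A, ∃ f : A → B S, IsHomOn (S : Set A) f ∧ Set.InjOn f S) :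
    EmbedsInto A (Ultraproduct (finsetUltrafilter A) B) := by
  choose f hf hinj using h
  have hom := isHomOn_toUltraproduct f hf
  refine ⟨toUltraproduct _ f, fun x y hxy => ?_, fun x y => hom.map_oplus x trivial y trivial,
    fun x => hom.map_neg x trivial, hom.map_zero⟩
  by_contra hne
  exact toUltraproduct_ne f (fun S hx hy h => hne (hinj S hx hy h)) hxy

/-- Finite parts of an MV-algebra are faithfully represented in powers of `ℚ ∩ [0, 1]` whose
index set can be mapped onto the pairs of distinct elements of the finite part. -/
theorem exists_rat_power {A : Type u} [MVAlgebra A] (S : Finset A) {K : Type w}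
    (e : K → {p : A × A // p.1 ≠ p.2}) (he : ∀ x ∈ S, ∀ y ∈ S, x ≠ y → ∃ k, (e k).1 = (x, y)) :
    ∃ f : A → (K → RatUnit), IsHomOn (S : Set A) f ∧ Set.InjOn f S := by
  choose g hg hne using fun p : {p : A × A // p.1 ≠ p.2} => exists_rat_separating S p.2
  refine ⟨fun x k => g (e k) x, ⟨fun x hx y hy => funext fun k => (hg _).map_oplus x hx y hy,
    fun x hx => funext fun k => (hg _).map_neg x hx, funext fun k => (hg _).map_zero⟩, ?_⟩
  intro x hx y hy hxy
  by_contra h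
  obtain ⟨k, hk⟩ := he x hx y hy h
  have := hne (e k)
  rw [hk] at this
  exact this (congrFun hxy k)

end MVAlgebra

theorem theorem7 :
    (∀ (A : Type u) [MVAlgebra A] [Nontrivial A], MVAlgebra.IsLinearlyOrdered A →
      ∃ (I : Type u) (U : Ultrafilter I),
        MVAlgebra.EmbedsInto A (MVAlgebra.Ultrapower U MVAlgebra.RatUnit)) ∧
    (∀ (A : Type u) [MVAlgebra A],
      ∃ (J : Type u) (I : J → Type u) (U : ∀ j, Ultrafilter (I j)),
        MVAlgebra.EmbedsInto A (∀ j, MVAlgebra.Ultrapower (U j) MVAlgebra.RatUnit)) ∧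
    (∀ (A : Type u) [MVAlgebra A] [Nontrivial A],
      ∃ (I : Type u) (U : Ultrafilter I),
        MVAlgebra.EmbedsInto A (MVAlgebra.Ultrapower U (ℕ → MVAlgebra.RatUnit))) ∧
    (∀ (A : Type u) [MVAlgebra A],
      ∃ (I : Type u) (U : Ultrafilter I) (n : I → ℕ),
        MVAlgebra.EmbedsInto A
          (MVAlgebra.Ultraproduct U (fun i => Fin (n i) → MVAlgebra.RatUnit))) := by
  classical
  refine ⟨fun A _ _ hA => ⟨Finset A, MVAlgebra.finsetUltrafilter A,
    MVAlgebra.embedsInto_ultraproduct fun S => MVAlgebra.exists_rat_of_chain hA S⟩,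
    fun A _ => ?_, fun A _ _ => ⟨Finset A, MVAlgebra.finsetUltrafilter A,
    MVAlgebra.embedsInto_ultraproduct fun S => ?_⟩, fun A _ => ?_⟩
  -- One ultrapower for each pair of distinct elements; separating that single pair suffices there.
  · choose f hf hne using fun (p : {p : A × A // p.1 ≠ p.2}) (S : Finset A) =>
      MVAlgebra.exists_rat_separating S p.2
    have hom := fun p => MVAlgebra.isHomOn_toUltraproduct (f p) (hf p)
    refine ⟨{p : A × A // p.1 ≠ p.2}, fun _ => Finset A, fun _ => MVAlgebra.finsetUltrafilter A,
      fun x p => MVAlgebra.toUltraproduct _ (f p) x, fun x y hxy => ?_,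
      fun x y => funext fun p => (hom p).map_oplus x trivial y trivial,
      fun x => funext fun p => (hom p).map_neg x trivial, funext fun p => (hom p).map_zero⟩
    by_contra h
    exact MVAlgebra.toUltraproduct_ne (f ⟨(x, y), h⟩) (fun S _ _ => hne ⟨(x, y), h⟩ S)
      (congrFun hxy ⟨(x, y), h⟩)
  · obtain ⟨a, b, hab⟩ := exists_pair_ne A
    -- The pair `(a, b)` keeps `T` nonempty, so that `ℕ` maps onto it even when `S` has no two
    -- distinct elements.
    let T : Finset {p : A × A // p.1 ≠ p.2} := insert ⟨(a, b), hab⟩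
      ((S ×ˢ S).subtype fun p => p.1 ≠ p.2)
    have : Nonempty T := ⟨⟨_, Finset.mem_insert_self _ _⟩⟩
    obtain ⟨e, he⟩ := exists_surjective_nat T
    refine MVAlgebra.exists_rat_power S (fun k => (e k).1) fun x hx y hy hxy => ?_
    obtain ⟨k, hk⟩ := he ⟨⟨(x, y), hxy⟩, Finset.mem_insert_of_mem
      (Finset.mem_subtype.2 (Finset.mem_product.2 ⟨hx, hy⟩))⟩
    exact ⟨k, by rw [hk]⟩
  -- No pair is added here: an empty `T S` gives a zeroth power, as the one-element algebra
  -- requires.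
  · let T := fun S : Finset A => (S ×ˢ S).subtype fun p => p.1 ≠ p.2
    refine ⟨Finset A, MVAlgebra.finsetUltrafilter A, fun S => (T S).card,
      MVAlgebra.embedsInto_ultraproduct fun S => ?_⟩
    refine MVAlgebra.exists_rat_power S (fun k => ((T S).equivFin.symm k).1) fun x hx y hy hxy => ?_
    exact ⟨(T S).equivFin ⟨⟨(x, y), hxy⟩, Finset.mem_subtype.2 (Finset.mem_product.2 ⟨hx, hy⟩)⟩,
      by simp⟩
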